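/- Conventions. Let $L$ be a frame, with top element $1$. A sublocale of $L$ is a subset $S\subseteq L$ closed under arbitrary meets and such that $a\to s\in S$ for all $a\in L$, $s\in S$; it is itself a frame in the inherited order. $\mathsf S(L)$ is the coframe of all sublocales of $L$ ordered by inclusion; its least element, the zero sublocale, is $\{1\}$. A covered prime of a frame $M$ is an element $p\neq 1$ such that $p=\bigwedge_{i\in I}x_i$ implies $p=x_i$ for some $i\in I$; $\mathsf{pt}_D(M)$ is the set of covered primes of $M$. A frame is spatial ($T_D$-spatial) if it is isomorphic to the frame of open sets of a topological space (of a $T_D$-space, that is, a space in which every point $x$ has a neighbourhood $U$ with $U\setminus\{x\}$ open). A sublocale $S$ of $L$ is a $D$-sublocale if the right adjoint of the frame surjection $L\twoheadrightarrow S$, $a\mapsto\bigwedge\{s\in S\mid a\le s\}$, sends covered primes to covered primes, equivalently if $\mathsf{pt}_D(S)\subseteq \mathsf{pt}_D(L)$; $\mathsf S_D(L)$ is the set of $D$-sublocales of $L$ ordered by inclusion. It is a coframe, and it is called spatial if the opposite frame $\mathsf S_D(L)^{op}$ is spatial. $\mathsf S_b(L)\subseteq\mathsf S(L)$ is the Booleanization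 of $\mathsf S(L)$, that is, the set of all supplements $L\smallsetminus T$ ($T\in\mathsf S(L)$), where $L\smallsetminus T$ is the least sublocale whose join with $T$ is $L$. The map $\mathsf{pt}_D\colon\mathsf S_D(L)\to\mathcal P(\mathsf{pt}_D(L))$ sends $S$ to $\mathsf{pt}_D(S)$, and $\mathfrak M\colon\mathcal P(\mathsf{pt}_D(L))\to\mathsf S_D(L)$ sends $Y$ to its closure $\{\bigwedge A\mid A\subseteq Y\}$ under arbitrary meets. Theorem. For every frame $L$, the following are equivalent. (1) All sublocales of $L$ are $T_D$-spatial. (2) All $D$-sublocales of $L$ are $T_D$-spatial. (3) $\mathfrak M\circ\mathsf{pt}_D$ is the identity on $\mathsf S_D(L)$. (4) There is an (order) isomorphism $\mathsf S_D(L)\cong\mathcal P(\mathsf{pt}_D(L))$. (5) $\mathsf S_D(L)$ is spatial and Boolean. (5$'$) $\mathsf S_D(L)$ is a complete and atomic Boolean algebra. (6) $\mathsf S_D(L)=\mathsf S_b(L)$ and $L$ is $T_D$-spatial. (7) Every nonzero sublocale $S$ of $L$ contains a covered prime of itself, i.e. $\mathsf{pt}_D(S)\neq\varnothing$. -/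

import Mathlib

universe u v

open Topology

namespace TDLocale

section Spaces

/-- A topological space is `T_D` if every point `x` has a neighbourhood `U` such that
`U \ {x}` is open. -/
def IsTD (X : Type u) [TopologicalSpace X] : Prop :=
  ∀ x : X, ∃ U ∈ 𝓝 x, IsOpen (U \ {x})

/-- A frame is spatial if it is isomorphic to the frame of open sets of some topological space.
(An isomorphism of frames is the same thing as an isomorphism of the underlying posets.) -/
def IsSpatial (P : Type u) [PartialOrder P] : Prop :=
  ∃ (X : Type u) (_ : TopologicalSpace X), Nonempty (P ≃o TopologicalSpace.Opens X)

/-- A frame is `T_D`-spatial if it is isomorphic to the frame of open sets of some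
`T_D`-space. -/
def IsTDSpatial (P : Type u) [PartialOrder P] : Prop :=
  ∃ (X : Type u) (_ : TopologicalSpace X), IsTD X ∧ Nonempty (P ≃o TopologicalSpace.Opens X)

/-- A poset is Boolean if it is (isomorphic to) a Boolean algebra. -/
def IsBoolean (P : Type u) [PartialOrder P] : Prop :=
  ∃ (B : Type u) (_ : BooleanAlgebra B), Nonempty (P ≃o B)

/-- A poset is (isomorphic to) a complete and atomic Boolean algebra. -/
def IsCompleteAtomicBoolean (P : Type u) [PartialOrder P] : Prop :=
  ∃ (B : Type u) (_ : CompleteBooleanAlgebra B), IsAtomic B ∧ Nonempty (P ≃o B)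

end Spaces

section CoveredPrimes

variable (L : Type u) [Order.Frame L]

/-- The set `pt_D(L)` of covered primes of `L`: the elements `p ≠ 1` such that whenever `p` is the
meet of a family of elements, it is a member of that family. -/
def ptD : Set L := {p | p ≠ ⊤ ∧ ∀ A : Set L, p = sInf A → p ∈ A}

variable {L} {M : Type v} [Order.Frame M]

/-- The localic map `f_*` of a frame homomorphism `f`, i.e. its right adjoint. -/
def localicMap (f : FrameHom L M) (b : M) : L := sSup {a | f a ≤ b}

theorem gc_localicMap (f : FrameHom L M) : GaloisConnection f (localicMap f) := by
  intro a b
  constructor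
  · intro h
    exact le_sSup h
  · intro h
    refine (OrderHomClass.mono f h).trans ?_
    rw [localicMap, map_sSup]
    refine sSup_le ?_
    rintro _ ⟨c, hc, rfl⟩
    exact hc

/-- A `D`-homomorphism: a frame homomorphism whose localic map sends covered primes to covered
primes. -/
def IsDHom (f : FrameHom L M) : Prop := ∀ p ∈ ptD M, localicMap f p ∈ ptD L

end CoveredPrimes

section DSublocales

variable {L : Type u} [Order.Frame L]

/-- A sublocale `S` of `L` is a `D`-sublocale if the frame surjection `L ↠ S`,
`a ↦ ⋀ {s ∈ S | a ≤ s}`, is a `D`-homomorphism. -/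
def IsDSublocale (S : Sublocale L) : Prop := IsDHom S.restrict

theorem localicMap_restrict (S : Sublocale L) (s : S) : localicMap S.restrict s = (s : L) :=
  (gc_localicMap S.restrict).u_unique S.giRestrict.gc (fun _ => rfl)

theorem isDSublocale_iff (S : Sublocale L) :
    IsDSublocale S ↔ ∀ p ∈ ptD S, (p : L) ∈ ptD L := by
  simp only [IsDSublocale, IsDHom, localicMap_restrict]

variable (L) in
/-- `S_D(L)`: the poset of `D`-sublocales of `L`, ordered by inclusion. -/
abbrev SD : Type u := {S : Sublocale L // IsDSublocale S}

variable (L) in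
/-- `S_b(L)`: the Booleanization of the coframe `S(L)` of sublocales of `L`, i.e. the set of all
supplements `￢T = L \ T` (the pseudocomplements of the frame `S(L)ᵒᵖ`). -/
def Sb : Set (Sublocale L) := {S | ∃ T : Sublocale L, S = ￢T}

theorem himp_ptD {p : L} (hp : p ∈ ptD L) (a : L) : a ⇨ p = ⊤ ∨ a ⇨ p = p := by
  have h : p = sInf {a ⇨ p, (a ⇨ p) ⇨ p} := by
    rw [sInf_pair]
    refine le_antisymm (le_inf le_himp le_himp) ?_
    rw [inf_comm]
    exact himp_inf_le
  rcases hp.2 _ h with h1 | h1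
  · exact Or.inr h1.symm
  · left
    rw [himp_eq_top_iff]
    calc a ≤ (a ⇨ p) ⇨ p := le_himp_iff.2 inf_himp_le
      _ = p := h1.symm

/-- The closure `{⋀ A | A ⊆ Y}` under arbitrary meets of a set `Y` of covered primes, as a
sublocale. -/
def meetClosure (Y : Set (ptD L)) : Sublocale L where
  carrier := {a | ∃ A ⊆ Y, a = sInf (Subtype.val '' A)}
  sInf_mem' s hs := by
    refine ⟨{p | p ∈ Y ∧ sInf s ≤ p.1}, fun p hp => hp.1, le_antisymm ?_ (le_sInf fun x hx => ?_)⟩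
    · refine le_sInf ?_
      rintro _ ⟨p, hp, rfl⟩
      exact hp.2
    · obtain ⟨A, hA, rfl⟩ := hs hx
      refine sInf_le_sInf (Set.image_mono fun p hp => ⟨hA hp, ?_⟩)
      exact (sInf_le hx).trans (sInf_le ⟨p, hp, rfl⟩)
  himp_mem' a b hb := by
    obtain ⟨A, hA, rfl⟩ := hb
    refine ⟨{p | p ∈ A ∧ ¬ a ≤ p.1}, fun p hp => hA hp.1, le_antisymm (le_sInf ?_) ?_⟩
    · rintro _ ⟨p, hp, rfl⟩
      rcases himp_ptD p.2 a with h | h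
      · exact absurd (himp_eq_top_iff.1 h) hp.2
      · exact (himp_le_himp_left (sInf_le (Set.mem_image_of_mem _ hp.1))).trans h.le
    · rw [le_himp_iff]
      refine le_sInf ?_
      rintro _ ⟨p, hp, rfl⟩
      by_cases h : a ≤ p.1
      · exact inf_le_right.trans h
      · exact inf_le_left.trans (sInf_le ⟨p, ⟨hp, h⟩, rfl⟩)

theorem isDSublocale_meetClosure (Y : Set (ptD L)) : IsDSublocale (meetClosure Y) := by
  rw [isDSublocale_iff]
  rintro ⟨_, A, hA, rfl⟩ hp
  have hm : ∀ q ∈ A, (q : L) ∈ meetClosure Y := fun q hq =>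
    ⟨{q}, Set.singleton_subset_iff.2 (hA hq), by simp⟩
  have himg : Subtype.val '' {x : meetClosure Y | ∃ q ∈ A, (q : L) = x} = Subtype.val '' A := by
    refine Set.Subset.antisymm ?_ ?_
    · rintro _ ⟨x, ⟨q, hq, h⟩, rfl⟩
      exact ⟨q, hq, h⟩
    · rintro _ ⟨q, hq, rfl⟩
      exact ⟨⟨q, hm q hq⟩, ⟨q, hq, rfl⟩, rfl⟩
  obtain ⟨q, -, h⟩ := hp.2 {x : meetClosure Y | ∃ q ∈ A, (q : L) = x}
    (Subtype.ext ((congrArg sInf himg).symm.trans (Sublocale.coe_sInf _).symm))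
  exact h ▸ q.2

/-- The map `𝔐 : 𝒫(pt_D(L)) → S_D(L)`, which closes a set of covered primes under arbitrary
meets. -/
def frakM (Y : Set (ptD L)) : SD L := ⟨meetClosure Y, isDSublocale_meetClosure Y⟩

/-- The map `pt_D : S_D(L) → 𝒫(pt_D(L))`, which sends a `D`-sublocale to the set of its covered
primes; these are covered primes of `L` because `S` is a `D`-sublocale. -/
def ptDMap (S : SD L) : Set (ptD L) :=
  Set.range fun p : ptD S.1 => ⟨(p.1 : L), (isDSublocale_iff S.1).1 S.2 p.1 p.2⟩

end DSublocales

end TDLocale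

/-!
Everything is reduced to the condition that every nonzero sublocale has a covered prime.

* A frame is `T_D`-spatial iff its covered primes separate its elements
  (`isTDSpatial_iff`): the complements of point closures in a `T_D`-space are covered primes, and
  the covered primes of any frame form a `T_D`-space under the hull-kernel topology.
* A covered prime of a locally closed part `S ∩ 𝔠(a) ∩ 𝔬(b)` of a sublocale `S` is a covered prime
  of `S` (`mem_ptD_of_mem_ptD_locallyClosed`). If `b ≰ a` in `S`, that part is nonzero, and any
  covered prime in it separates `a` from `b`; so if all nonzero sublocales have covered primes, then
  all sublocales are `T_D`-spatial.
* A sublocale without covered primes is trivially a `D`-sublocale. It is not `T_D`-spatial unless it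
  is zero; and if it is nonzero, there is no atom of `S_D(L)` below it, since its locally closed
  parts are again without covered primes and an atom would have to be of the form `{a, 1}`, which
  has the covered prime `a` (`exists_ptD_of_isAtomic`).
  This handles every condition that makes `S_D(L)` atomic. A spatial frame `𝒪(X)` that is
  Boolean is coatomic, because the complement of a point closure is then a maximal open set.
* The map `𝔐` always is an order embedding, with `pt_D` as left inverse, so it is an isomorphism
  once `𝔐 ∘ pt_D = id`.
* For the nucleus `ν` of `T`, the supplement of `T` is the set of meets of elements `y` with
  `ν y ⇨ y = y` (`mem_hnot_iff`). It follows that supplements are always `D`-sublocales. If covered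
  primes separate, a nonzero supplement contains a covered prime of `L`, and the `D`-sublocale
  generated by a set `Y` of covered primes is the supplement of the one generated by the rest.
-/

namespace TDLocale

/-! ### Covered primes and `T_D`-spatial frames -/

section Frames

variable {M : Type u} [Order.Frame M]

theorem inf_le_iff_of_mem_ptD {p : M} (hp : p ∈ ptD M) {a b : M} :
    a ⊓ b ≤ p ↔ a ≤ p ∨ b ≤ p := by
  refine ⟨fun h => ?_, fun h => h.elim inf_le_left.trans inf_le_right.trans⟩
  rcases himp_ptD hp b with h1 | h1
  · exact Or.inr (himp_eq_top_iff.1 h1)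
  · exact Or.inl (h1 ▸ le_himp_iff.2 h)

/-- The hull-kernel topology on the covered primes of a frame: the open sets are
`{p | ¬ a ≤ p}` for `a` in the frame. -/
@[reducible]
def ptDTopology (M : Type u) [Order.Frame M] : TopologicalSpace (ptD M) where
  IsOpen U := ∃ a : M, U = {p : ptD M | ¬ a ≤ p}
  isOpen_univ := ⟨⊤, Set.ext fun p => by simpa using p.2.1⟩
  isOpen_inter := by
    rintro _ _ ⟨a, rfl⟩ ⟨b, rfl⟩
    exact ⟨a ⊓ b, Set.ext fun p => by simp [inf_le_iff_of_mem_ptD p.2]⟩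
  isOpen_sUnion s hs := by
    refine ⟨sSup {a | {p : ptD M | ¬ a ≤ p} ∈ s}, Set.ext fun p => ?_⟩
    simp only [Set.mem_sUnion, Set.mem_ofPred_eq, sSup_le_iff, not_forall]
    constructor
    · rintro ⟨U, hU, hp⟩
      obtain ⟨a, rfl⟩ := hs U hU
      exact ⟨a, hU, hp⟩
    · rintro ⟨a, hU, hp⟩
      exact ⟨_, hU, hp⟩

theorem isTD_ptDTopology : @IsTD (ptD M) (ptDTopology M) := by
  let := ptDTopology M
  intro p
  -- `q` is the least element strictly above `p`; it exists because `p` is covered.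
  set q : M := sInf {x | p.1 < x}
  have hpq : p.1 ≤ q := le_sInf fun x hx => le_of_lt hx
  have hqp : ¬ q ≤ p.1 := fun h => lt_irrefl _ (p.2.2 _ (le_antisymm hpq h))
  refine ⟨{r | ¬ q ≤ r.1}, IsOpen.mem_nhds ⟨q, rfl⟩ hqp, p.1, Set.ext fun r => ?_⟩
  simp only [Set.mem_sdiff, Set.mem_ofPred_eq, Set.mem_singleton_iff]
  constructor
  · rintro ⟨h1, h2⟩ h3
    exact h1 (sInf_le (lt_of_le_of_ne h3 fun h => h2 (Subtype.ext h.symm)))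
  · intro h
    exact ⟨fun h1 => h (hpq.trans h1), fun h1 => h (h1 ▸ le_rfl)⟩

theorem mem_ptD_map {N : Type v} [Order.Frame N] (e : M ≃o N) {p : M} (hp : p ∈ ptD M) :
    e p ∈ ptD N := by
  refine ⟨fun h => hp.1 (e.injective (h.trans e.map_top.symm)), fun A hA => ?_⟩
  have h : p = sInf (e.symm '' A) := by
    rw [sInf_image, ← e.symm.map_sInf, ← hA, e.symm_apply_apply]
  obtain ⟨x, hx, h⟩ := hp.2 _ h
  rw [← h, e.apply_symm_apply]
  exact hx

/-- In a `T_D`-space, the complement of the closure of a point is a covered prime. -/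
theorem compl_closure_singleton_mem_ptD {X : Type u} [TopologicalSpace X] (hX : IsTD X) (x : X) :
    (⟨(closure {x})ᶜ, isClosed_closure.isOpen_compl⟩ : TopologicalSpace.Opens X) ∈
      ptD (TopologicalSpace.Opens X) := by
  set P : TopologicalSpace.Opens X := ⟨(closure {x})ᶜ, isClosed_closure.isOpen_compl⟩
  have hle : ∀ V : TopologicalSpace.Opens X, V ≤ P ↔ x ∉ V := by
    intro V
    constructor
    · exact fun h hx => h hx (subset_closure rfl)
    · intro hx y hy hyx
      obtain ⟨z, hz, rfl⟩ := mem_closure_iff.1 hyx V V.2 hy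
      exact hx hz
  have hxP : x ∉ P := (hle P).1 le_rfl
  refine ⟨fun h => hxP (h ▸ trivial), fun A hA => by_contra fun hPA => hxP ?_⟩
  have hxA : ∀ V ∈ A, x ∈ V := by
    intro V hV
    by_contra hxV
    exact hPA (le_antisymm (hA ▸ sInf_le hV) ((hle V).2 hxV) ▸ hV)
  obtain ⟨U, hU, hUx⟩ := hX x
  obtain ⟨W, hWU, hW, hxW⟩ := mem_nhds_iff.1 hU
  -- Off `x`, the neighbourhood `W` is covered by the open set `U \ {x}`, which lies below `P`.
  have hQ : (⟨U \ {x}, hUx⟩ : TopologicalSpace.Opens X) ≤ P := (hle _).2 fun h => h.2 rfl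
  have hWP : (⟨W, hW⟩ : TopologicalSpace.Opens X) ≤ P := by
    rw [hA]
    refine le_sInf fun V hV y hy => ?_
    by_cases hyx : y = x
    · exact hyx ▸ hxA V hV
    · have hPV : P ≤ V := hA ▸ sInf_le hV
      exact hPV (hQ ⟨hWU hy, hyx⟩)
  exact hWP hxW

variable (M) in
theorem isTDSpatial_iff :
    IsTDSpatial M ↔ ∀ a b : M, ¬ b ≤ a → ∃ p ∈ ptD M, a ≤ p ∧ ¬ b ≤ p := by
  constructor
  · rintro ⟨X, _, hX, ⟨e⟩⟩ a b hab
    obtain ⟨x, hxb, hxa⟩ := Set.not_subset.1 fun h : (e b : Set X) ⊆ e a => hab (e.le_iff_le.1 h)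
    refine ⟨_, mem_ptD_map e.symm (compl_closure_singleton_mem_ptD hX x), ?_, ?_⟩
    · rw [e.le_symm_apply]
      intro y hy hyx
      obtain ⟨z, hz, rfl⟩ := mem_closure_iff.1 hyx (e a) (e a).2 hy
      exact hxa hz
    · rw [e.le_symm_apply]
      exact fun h => h hxb (subset_closure rfl)
  · intro h
    refine ⟨ptD M, ptDTopology M, isTD_ptDTopology, ⟨?_⟩⟩
    let := ptDTopology M
    let f : M → TopologicalSpace.Opens (ptD M) := fun a => ⟨{p | ¬ a ≤ p}, a, rfl⟩
    have hf : ∀ a b, f a ≤ f b ↔ a ≤ b := by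
      refine fun a b => ⟨fun hab => by_contra fun hba => ?_, fun hab p hp hb => hp (hab.trans hb)⟩
      obtain ⟨p, hp, h1, h2⟩ := h b a hba
      exact hab (show (⟨p, hp⟩ : ptD M) ∈ f a from h2) h1
    refine RelIso.ofSurjective (OrderEmbedding.ofMapLEIff f hf) ?_
    rintro ⟨U, a, rfl⟩
    exact ⟨a, rfl⟩

end Frames

/-! ### Covered primes of sublocales -/

section Sublocales

variable {L : Type u} [Order.Frame L]

theorem ne_bot_iff {S : Sublocale L} : S ≠ ⊥ ↔ ∃ x ∈ S, x ≠ ⊤ := by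
  constructor
  · intro h
    by_contra! h1
    exact h (le_bot_iff.1 fun x hx => h1 x hx ▸ Sublocale.top_mem)
  · rintro ⟨x, hx, hxt⟩ rfl
    -- The meet closure of the empty set is `{⊤}`.
    obtain ⟨A, hA, rfl⟩ := (bot_le : ⊥ ≤ meetClosure (∅ : Set (ptD L))) hx
    exact hxt (by simp [Set.subset_empty_iff.1 hA])

theorem mem_ptD_sublocale_iff {S : Sublocale L} {p : S} :
    p ∈ ptD S ↔ (p : L) ≠ ⊤ ∧ ∀ A : Set L, A ⊆ S → (p : L) = sInf A → (p : L) ∈ A := by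
  constructor
  · refine fun h => ⟨fun ht => h.1 (Subtype.ext ht), fun A hA hp => ?_⟩
    refine h.2 (Subtype.val ⁻¹' A) (Subtype.ext ?_)
    have hi : Subtype.val '' (Subtype.val ⁻¹' A : Set S) = A := by
      ext x
      exact ⟨by rintro ⟨y, hy, rfl⟩; exact hy, fun hx => ⟨⟨x, hA hx⟩, hx, rfl⟩⟩
    rw [Sublocale.coe_sInf, hi, hp]
  · refine fun h => ⟨fun ht => h.1 (congrArg Subtype.val ht), fun A hA => ?_⟩
    have hA' : (p : L) = sInf (Subtype.val '' A) := by rw [← Sublocale.coe_sInf, ← hA]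
    obtain ⟨x, hx, h⟩ := h.2 _ (by rintro _ ⟨x, -, rfl⟩; exact x.2) hA'
    exact Subtype.ext h ▸ hx

theorem mem_ptD_of_mem {S : Sublocale L} {p : L} (hpS : p ∈ S) (hp : p ∈ ptD L) :
    (⟨p, hpS⟩ : S) ∈ ptD S :=
  mem_ptD_sublocale_iff.2 ⟨hp.1, fun A _ => hp.2 A⟩

/-- The locally closed part `S ∩ 𝔠(a) ∩ 𝔬(b)` of a sublocale `S`: `𝔠(a)` consists of the elements
above `a`, and `𝔬(b)` of the elements fixed by `b ⇨ ·`. -/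
def locallyClosed (S : Sublocale L) (a b : L) : Sublocale L where
  carrier := {x | x ∈ S ∧ a ≤ x ∧ b ⇨ x = x}
  sInf_mem' s hs := by
    refine ⟨S.sInf_mem fun x hx => (hs hx).1, le_sInf fun x hx => (hs hx).2.1,
      le_antisymm (le_sInf fun x hx => ?_) le_himp⟩
    exact (himp_le_himp_left (sInf_le hx)).trans (hs hx).2.2.le
  himp_mem' c x hx := by
    refine ⟨S.himp_mem hx.1, hx.2.1.trans le_himp, ?_⟩
    rw [himp_left_comm, hx.2.2]

theorem locallyClosed_le (S : Sublocale L) (a b : L) : locallyClosed S a b ≤ S :=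
  fun _ hx => hx.1

/-- A meet of elements of `S` that equals an element `p` of the locally closed part can be pushed
into that part by `b ⇨ ·`, which fixes `p` and enlarges the factors. -/
theorem mem_ptD_of_mem_ptD_locallyClosed {S : Sublocale L} {a b : L} {p : locallyClosed S a b}
    (hp : p ∈ ptD (locallyClosed S a b)) : (⟨p, p.2.1⟩ : S) ∈ ptD S := by
  rw [mem_ptD_sublocale_iff] at hp ⊢
  refine ⟨hp.1, fun A hA hpA => ?_⟩
  have hpx : ∀ x ∈ A, (p : L) ≤ x := fun x hx => hpA.le.trans (sInf_le hx)
  obtain ⟨x, hx, h⟩ : (p : L) ∈ (fun x => b ⇨ x) '' A := by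
    refine hp.2 _ ?_ ?_
    · rintro _ ⟨x, hx, rfl⟩
      refine ⟨S.himp_mem (hA hx), (p.2.2.1.trans (hpx x hx)).trans le_himp, ?_⟩
      rw [himp_idem]
    · refine le_antisymm (le_sInf ?_) ?_
      · rintro _ ⟨x, hx, rfl⟩
        exact (hpx x hx).trans le_himp
      · rw [← p.2.2.2, le_himp_iff, hpA]
        refine le_sInf fun x hx => ?_
        rw [← le_himp_iff]
        exact sInf_le ⟨x, hx, rfl⟩
  have hxp : x ≤ p := le_himp.trans_eq h
  exact le_antisymm hxp (hpx x hx) ▸ hx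

theorem isTDSpatial_of_forall_ptD_nonempty (h : ∀ S : Sublocale L, S ≠ ⊥ → (ptD S).Nonempty)
    (S : Sublocale L) : IsTDSpatial S := by
  rw [isTDSpatial_iff]
  intro a b hab
  have hne : locallyClosed S a b ≠ ⊥ := by
    refine ne_bot_iff.2 ⟨(b : L) ⇨ a, ⟨S.himp_mem a.2, le_himp, himp_idem⟩, fun ht => hab ?_⟩
    exact (himp_eq_top_iff (α := L)).1 ht
  obtain ⟨p, hp⟩ := h _ hne
  refine ⟨_, mem_ptD_of_mem_ptD_locallyClosed hp, p.2.2.1, fun hbp => hp.1 (Subtype.ext ?_)⟩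
  exact p.2.2.2.symm.trans (himp_eq_top_iff.2 hbp)

theorem IsTDSpatial.ptD_nonempty {S : Sublocale L} (h : IsTDSpatial S) (hS : S ≠ ⊥) :
    (ptD S).Nonempty := by
  obtain ⟨x, hx, hxt⟩ := ne_bot_iff.1 hS
  obtain ⟨p, hp, -⟩ := (isTDSpatial_iff S).1 h ⟨x, hx⟩ ⊤
    fun h => hxt (congrArg Subtype.val (top_le_iff.1 h))
  exact ⟨p, hp⟩

theorem isDSublocale_of_ptD_eq_empty {S : Sublocale L} (h : ptD S = ∅) : IsDSublocale S :=
  (isDSublocale_iff S).2 fun p hp => absurd hp (h ▸ Set.notMem_empty p)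

/-! ### The maps `𝔐` and `pt_D` -/

theorem mem_meetClosure_iff {Y : Set (ptD L)} {q : ptD L} : (q : L) ∈ meetClosure Y ↔ q ∈ Y := by
  constructor
  · rintro ⟨A, hA, h⟩
    obtain ⟨r, hr, hrq⟩ := q.2.2 _ h
    exact hA (Subtype.ext hrq ▸ hr)
  · exact fun h => ⟨{q}, Set.singleton_subset_iff.2 h, by simp⟩

theorem meetClosure_le_iff {Y : Set (ptD L)} {S : Sublocale L} :
    meetClosure Y ≤ S ↔ ∀ q ∈ Y, (q : L) ∈ S := by
  refine ⟨fun h q hq => h (mem_meetClosure_iff.2 hq), ?_⟩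
  rintro h _ ⟨A, hA, rfl⟩
  refine S.sInf_mem ?_
  rintro _ ⟨q, hq, rfl⟩
  exact h q (hA hq)

theorem mem_ptDMap_iff {S : SD L} {q : ptD L} : q ∈ ptDMap S ↔ (q : L) ∈ S.1 := by
  constructor
  · rintro ⟨p, rfl⟩
    exact p.1.2
  · exact fun h => ⟨⟨⟨q, h⟩, mem_ptD_of_mem h q.2⟩, rfl⟩

theorem frakM_le_frakM_iff {Y Z : Set (ptD L)} : frakM Y ≤ frakM Z ↔ Y ⊆ Z :=
  meetClosure_le_iff.trans (forall₂_congr fun _ _ => mem_meetClosure_iff)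

theorem frakM_ptDMap_of_isTDSpatial {S : SD L} (h : IsTDSpatial S.1) : frakM (ptDMap S) = S := by
  refine le_antisymm (meetClosure_le_iff.2 fun q hq => mem_ptDMap_iff.1 hq) fun a ha => ?_
  refine ⟨{q | q ∈ ptDMap S ∧ a ≤ q}, fun q hq => hq.1, le_antisymm (le_sInf ?_) ?_⟩
  · rintro _ ⟨q, hq, rfl⟩
    exact hq.2
  · by_contra hb
    have hbS : sInf (Subtype.val '' {q | q ∈ ptDMap S ∧ a ≤ q}) ∈ S.1 := by
      refine S.1.sInf_mem ?_
      rintro _ ⟨q, hq, rfl⟩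
      exact mem_ptDMap_iff.1 hq.1
    obtain ⟨p, hp, hap, hbp⟩ := (isTDSpatial_iff S.1).1 h ⟨a, ha⟩ ⟨_, hbS⟩ hb
    have hpL := (isDSublocale_iff S.1).1 S.2 p hp
    exact hbp (sInf_le ⟨⟨p, hpL⟩, ⟨mem_ptDMap_iff.2 p.2, hap⟩, rfl⟩)

theorem nonempty_orderIso_of_frakM_comp_ptDMap
    (h : (frakM ∘ ptDMap : SD L → SD L) = id) : Nonempty (SD L ≃o Set (ptD L)) :=
  ⟨(RelIso.ofSurjective (OrderEmbedding.ofMapLEIff frakM fun _ _ => frakM_le_frakM_iff)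
    fun S => ⟨ptDMap S, congrFun h S⟩).symm⟩

/-! ### Atomicity of the coframe of `D`-sublocales -/

theorem ptD_bot : ptD (⊥ : Sublocale L) = ∅ :=
  Set.eq_empty_of_forall_notMem fun p hp =>
    (ne_bot_iff (S := (⊥ : Sublocale L))).2 ⟨p, p.2, (mem_ptD_sublocale_iff.1 hp).1⟩ rfl

instance : OrderBot (SD L) where
  bot := ⟨⊥, isDSublocale_of_ptD_eq_empty ptD_bot⟩
  bot_le S := show (⊥ : Sublocale L) ≤ S.1 from bot_le

theorem coe_SD_bot : (⊥ : SD L).1 = ⊥ := rfl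

/-- If `S` had no covered primes, neither would an atom `T` below it. But all closed parts of `T`
would then be `D`-sublocales, so `T = {a, ⊤}` by atomicity, and `a` would be a covered prime. -/
theorem exists_ptD_of_isAtomic [IsAtomic (SD L)] {S : Sublocale L} (hS : S ≠ ⊥) :
    (ptD S).Nonempty := by
  by_contra hempty
  rw [Set.not_nonempty_iff_eq_empty] at hempty
  obtain h | ⟨⟨T, hTD⟩, hT, hTS⟩ :=
    eq_bot_or_exists_atom_le (⟨S, isDSublocale_of_ptD_eq_empty hempty⟩ : SD L)
  · exact hS ((congrArg Subtype.val h).trans coe_SD_bot)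
  replace hTS : T ≤ S := hTS
  have hTempty : ptD T = ∅ := by
    refine Set.eq_empty_of_forall_notMem fun p hp => ?_
    have hpS := mem_ptD_of_mem (hTS p.2) ((isDSublocale_iff T).1 hTD p hp)
    exact Set.notMem_empty _ (hempty ▸ hpS)
  obtain ⟨a, haT, hat⟩ := ne_bot_iff.1 fun h : T = ⊥ => hT.1 (Subtype.ext h)
  -- For each `c ≠ ⊤` in the atom `T`, the closed part `T ∩ 𝔠(c)` is nonzero, hence all of `T`.
  have hle : ∀ c ∈ T, c ≠ ⊤ → ∀ x ∈ T, c ≤ x := by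
    intro c hc hct x hx
    have hCempty : ptD (locallyClosed T c ⊤) = ∅ :=
      Set.eq_empty_of_forall_notMem fun p hp =>
        Set.notMem_empty _ (hTempty ▸ mem_ptD_of_mem_ptD_locallyClosed hp)
    let C : SD L := ⟨locallyClosed T c ⊤, isDSublocale_of_ptD_eq_empty hCempty⟩
    have hC : C ≠ ⊥ := fun h =>
      ne_bot_iff.2 ⟨c, (⟨hc, le_rfl, top_himp⟩ : c ∈ locallyClosed T c ⊤), hct⟩
        ((congrArg Subtype.val h).trans coe_SD_bot)
    have hCT : C = ⟨T, hTD⟩ := (hT.le_iff.1 (locallyClosed_le T c ⊤)).resolve_left hC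
    have hxC : x ∈ C.1 := by rw [hCT]; exact hx
    exact hxC.2.1
  suffices ha : (⟨a, haT⟩ : T) ∈ ptD T from Set.notMem_empty _ (hTempty ▸ ha)
  refine mem_ptD_sublocale_iff.2 ⟨hat, fun A hA haA => by_contra fun haA' => ?_⟩
  refine hat (haA.trans (sInf_eq_top.2 fun x hx => by_contra fun hxt => haA' ?_))
  exact le_antisymm (hle a haT hat x (hA hx)) (hle x (hA hx) hxt a haT) ▸ hx

/-- In a complemented frame of open sets, the complement of the closure of a point is maximal. -/
theorem isCoatomic_opens {X : Type u} [TopologicalSpace X]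
    [ComplementedLattice (TopologicalSpace.Opens X)] : IsCoatomic (TopologicalSpace.Opens X) := by
  refine ⟨fun U => or_iff_not_imp_left.2 fun hU => ?_⟩
  obtain ⟨x, hx⟩ : ∃ x, x ∉ U := by
    by_contra! h
    exact hU (top_le_iff.1 fun y _ => h y)
  set P : TopologicalSpace.Opens X := ⟨(closure {x})ᶜ, isClosed_closure.isOpen_compl⟩
  have hle : ∀ V : TopologicalSpace.Opens X, x ∉ V → V ≤ P := by
    intro V hV y hy hyx
    obtain ⟨z, hz, rfl⟩ := mem_closure_iff.1 hyx V V.2 hy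
    exact hV hz
  refine ⟨P, ⟨fun h => ?_, fun V hV => ?_⟩, hle U hx⟩
  · have hxP : x ∈ P := h ▸ trivial
    exact hxP (subset_closure rfl)
  -- `V` contains `x`, so its complement does not, and lies below `P < V`.
  · have hxV : x ∈ V := by_contra fun h => hV.not_ge (hle V h)
    obtain ⟨W, hW⟩ := exists_isCompl V
    have hxW : x ∉ W := fun h => (hW.disjoint.le_bot ⟨hxV, h⟩ : x ∈ (⊥ : TopologicalSpace.Opens X))
    rw [← hW.sup_eq_top, sup_eq_left.2 ((hle W hxW).trans hV.le)]

theorem isAtomic_of_isSpatial_of_isBoolean {P : Type u} [PartialOrder P] [OrderBot P]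
    (h : IsSpatial Pᵒᵈ) (hB : IsBoolean P) : IsAtomic P := by
  obtain ⟨X, _, ⟨e⟩⟩ := h
  obtain ⟨B, _, ⟨f⟩⟩ := hB
  have : ComplementedLattice (TopologicalSpace.Opens X) :=
    (f.symm.dual.trans e).complementedLattice
  have := isCoatomic_opens (X := X)
  exact isCoatomic_dual_iff_isAtomic.1 (e.isCoatomic_iff.2 this)

theorem isAtomic_of_isCompleteAtomicBoolean {P : Type u} [PartialOrder P] [OrderBot P]
    (h : IsCompleteAtomicBoolean P) : IsAtomic P := by
  obtain ⟨B, _, hB, ⟨f⟩⟩ := h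
  exact f.isAtomic_iff.2 hB

theorem isSpatial_and_isBoolean_of_orderIso_set {P X : Type u} [PartialOrder P] (e : P ≃o Set X) :
    IsSpatial Pᵒᵈ ∧ IsBoolean P := by
  refine ⟨⟨X, ⊥, ⟨?_⟩⟩, Set X, inferInstance, ⟨e⟩⟩
  let : TopologicalSpace X := ⊥
  have : DiscreteTopology X := ⟨rfl⟩
  refine (e.dual.trans (OrderIso.compl (Set X)).symm).trans
    (RelIso.ofSurjective (OrderEmbedding.ofMapLEIff
      (fun s => (⟨s, isOpen_discrete s⟩ : TopologicalSpace.Opens X)) fun _ _ => Iff.rfl)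
      fun U => ⟨U, rfl⟩)

theorem isCompleteAtomicBoolean_of_orderIso_set {P X : Type u} [PartialOrder P]
    (e : P ≃o Set X) : IsCompleteAtomicBoolean P :=
  ⟨Set X, inferInstance, inferInstance, ⟨e⟩⟩

/-! ### Supplements -/

theorem codisjoint_iff_toNucleus {S T : Sublocale L} :
    Codisjoint S T ↔ ∀ x, S.toNucleus x ⊓ T.toNucleus x = x := by
  rw [codisjoint_iff, ← nucleusIsoSublocale.symm.injective.eq_iff, map_sup, map_top]
  exact Nucleus.ext_iff

theorem mem_iff_toNucleus_apply {S : Sublocale L} {x : L} : x ∈ S ↔ S.toNucleus x = x := by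
  rw [← Nucleus.mem_range, Sublocale.range_toNucleus, SetLike.mem_coe]

/-- If `ν` is the nucleus of `T`, then `ν x ⇨ x` satisfies the equation that characterizes the
generators of the supplement of `T`, and so does `b ⇨ x` for every `b ≤ ν x`. -/
theorem toNucleus_himp_himp (T : Sublocale L) {b x : L} (hb : b ≤ T.toNucleus x) :
    T.toNucleus (b ⇨ x) ⇨ (b ⇨ x) = b ⇨ x := by
  rw [himp_himp, inf_eq_right.2 (hb.trans (T.toNucleus.monotone le_himp))]

/-- The meets of the elements `y` with `ν y ⇨ y = y`, where `ν` is the nucleus of `T`. By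
`hnot_eq_supplement` this is the supplement of `T`. -/
def supplement (T : Sublocale L) : Sublocale L where
  carrier := {a | ∃ A : Set L, (∀ y ∈ A, T.toNucleus y ⇨ y = y) ∧ a = sInf A}
  sInf_mem' s hs := by
    refine ⟨{y | T.toNucleus y ⇨ y = y ∧ sInf s ≤ y}, fun y hy => hy.1,
      le_antisymm (le_sInf fun y hy => hy.2) (le_sInf fun x hx => ?_)⟩
    obtain ⟨A, hA, rfl⟩ := hs hx
    exact le_sInf fun y hy => sInf_le ⟨hA y hy, (sInf_le hx).trans (sInf_le hy)⟩
  himp_mem' c a ha := by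
    obtain ⟨A, hA, rfl⟩ := ha
    refine ⟨(fun y => c ⇨ y) '' A, ?_, ?_⟩
    · rintro _ ⟨y, hy, rfl⟩
      refine le_antisymm ?_ le_himp
      calc T.toNucleus (c ⇨ y) ⇨ (c ⇨ y) ≤ T.toNucleus y ⇨ (c ⇨ y) :=
            himp_le_himp_right (T.toNucleus.monotone le_himp)
        _ = c ⇨ y := by rw [himp_left_comm, hA y hy]
    · refine le_antisymm (le_sInf ?_) ?_
      · rintro _ ⟨y, hy, rfl⟩
        exact himp_le_himp_left (sInf_le hy)
      · rw [le_himp_iff]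
        refine le_sInf fun y hy => ?_
        rw [← le_himp_iff]
        exact sInf_le ⟨y, hy, rfl⟩

theorem mem_supplement_of_himp_eq {T : Sublocale L} {y : L} (hy : T.toNucleus y ⇨ y = y) :
    y ∈ supplement T :=
  ⟨{y}, by simpa using hy, by simp⟩

/-- Each `x` is the meet of `ν x ∈ T` and the generator `ν x ⇨ x`, so `supplement T` joins with `T`
to `⊤`. Conversely, if `T ⊔ R = ⊤`, a generator `y` is the meet of `ν y` and some `r ∈ R`, whence
`r ≤ ν y ⇨ y = y` and `y = r ∈ R`. -/
theorem hnot_eq_supplement (T : Sublocale L) : ￢T = supplement T := by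
  refine eq_of_forall_ge_iff fun R => ?_
  rw [hnot_le_iff_codisjoint_right, codisjoint_iff_toNucleus]
  constructor
  · rintro h _ ⟨A, hA, rfl⟩
    refine R.sInf_mem fun y hy => mem_iff_toNucleus_apply.2 (le_antisymm ?_ Nucleus.le_apply)
    rw [← hA y hy, le_himp_iff, inf_comm, hA y hy, h y]
  · intro h x
    refine le_antisymm ?_ (le_inf Nucleus.le_apply Nucleus.le_apply)
    have hx : T.toNucleus x ⇨ x ∈ R :=
      h (mem_supplement_of_himp_eq (toNucleus_himp_himp T le_rfl))
    rw [inf_comm, ← le_himp_iff, ← mem_iff_toNucleus_apply.1 hx]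
    exact R.toNucleus.monotone le_himp

theorem mem_hnot_iff {T : Sublocale L} {a : L} :
    a ∈ ￢T ↔ ∃ A : Set L, (∀ y ∈ A, T.toNucleus y ⇨ y = y) ∧ a = sInf A := by
  rw [hnot_eq_supplement]
  rfl

theorem mem_hnot_of_himp_eq {T : Sublocale L} {y : L} (hy : T.toNucleus y ⇨ y = y) : y ∈ ￢T :=
  hnot_eq_supplement T ▸ mem_supplement_of_himp_eq hy

theorem isDSublocale_hnot (T : Sublocale L) : IsDSublocale (￢T) := by
  refine (isDSublocale_iff _).2 fun p hp => ?_
  rw [mem_ptD_sublocale_iff] at hp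
  -- A covered prime of the supplement is one of the generators.
  obtain ⟨B, hB, hpB⟩ := mem_hnot_iff.1 p.2
  have hpp : T.toNucleus p ⇨ (p : L) = p :=
    hB p (hp.2 B (fun y hy => mem_hnot_of_himp_eq (hB y hy)) hpB)
  refine ⟨hp.1, fun A hpA => ?_⟩
  have hpx : ∀ x ∈ A, (p : L) ≤ x := fun x hx => hpA.le.trans (sInf_le hx)
  obtain ⟨x, hx, h⟩ : (p : L) ∈ (fun x => T.toNucleus p ⇨ x) '' A := by
    refine hp.2 _ ?_ ?_
    · rintro _ ⟨x, hx, rfl⟩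
      exact mem_hnot_of_himp_eq (toNucleus_himp_himp T (T.toNucleus.monotone (hpx x hx)))
    · refine le_antisymm (le_sInf ?_) ?_
      · rintro _ ⟨x, hx, rfl⟩
        exact (hpx x hx).trans le_himp
      · conv_rhs => rw [← hpp]
        rw [le_himp_iff]
        refine (le_sInf fun x hx => ?_ : _ ≤ sInf A).trans hpA.ge
        rw [← le_himp_iff]
        exact sInf_le ⟨x, hx, rfl⟩
  have hxp : x ≤ p := le_himp.trans_eq h
  exact le_antisymm hxp (hpx x hx) ▸ hx

theorem mem_hnot_of_mem_ptD {T : Sublocale L} {p : L} (hp : p ∈ ptD L) (hpT : p ∉ T) :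
    p ∈ ￢T := by
  refine mem_hnot_of_himp_eq ((himp_ptD hp _).resolve_left fun h => hpT ?_)
  exact mem_iff_toNucleus_apply.2 (le_antisymm (himp_eq_top_iff.1 h) Nucleus.le_apply)

theorem setOf_isDSublocale_eq_Sb (h : ∀ S : Sublocale L, IsTDSpatial S) :
    {S : Sublocale L | IsDSublocale S} = Sb L := by
  refine Set.Subset.antisymm (fun S hS => ?_) ?_
  · set Y := ptDMap ⟨S, hS⟩
    have hSY : meetClosure Y = S :=
      congrArg Subtype.val (frakM_ptDMap_of_isTDSpatial (S := ⟨S, hS⟩) (h S))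
    refine ⟨meetClosure Yᶜ, le_antisymm ?_ ?_⟩
    · rw [← hSY, meetClosure_le_iff]
      exact fun q hq => mem_hnot_of_mem_ptD q.2 fun h => mem_meetClosure_iff.1 h hq
    -- The join of `S` and the meet closure of `Yᶜ` contains all covered primes of `L`.
    · rw [hnot_le_iff_codisjoint_right, codisjoint_iff_le_sup]
      have hD : IsDSublocale (⊤ : Sublocale L) := by
        rw [← hnot_bot]
        exact isDSublocale_hnot ⊥
      have htop : meetClosure (ptDMap ⟨⊤, hD⟩) = ⊤ :=
        congrArg Subtype.val (frakM_ptDMap_of_isTDSpatial (S := ⟨⊤, hD⟩) (h ⊤))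
      rw [← htop]
      refine meetClosure_le_iff.2 fun q _ => ?_
      by_cases hq : q ∈ Y
      · exact (le_sup_right : S ≤ _) (mem_ptDMap_iff.1 hq)
      · exact (le_sup_left : meetClosure Yᶜ ≤ _) (mem_meetClosure_iff.2 hq)
  · rintro _ ⟨T, rfl⟩
    exact isDSublocale_hnot T

/-- A generator `y ≠ ⊤` of the supplement is not fixed by the nucleus `ν` of `T`; a covered prime
separating `y` from `ν y` belongs to the supplement. -/
theorem exists_ptD_hnot (hL : IsTDSpatial L) {T : Sublocale L} (hT : ￢T ≠ ⊥) :
    (ptD (￢T : Sublocale L)).Nonempty := by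
  obtain ⟨a, ha, hat⟩ := ne_bot_iff.1 hT
  obtain ⟨A, hA, rfl⟩ := mem_hnot_iff.1 ha
  obtain ⟨y, hy, hyt⟩ : ∃ y ∈ A, y ≠ ⊤ := by
    by_contra! h
    exact hat (sInf_eq_top.2 h)
  have hνy : ¬ T.toNucleus y ≤ y := fun h =>
    hyt ((hA y hy).symm.trans (himp_eq_top_iff.2 h))
  obtain ⟨p, hp, hyp, hνp⟩ := (isTDSpatial_iff L).1 hL _ _ hνy
  refine ⟨_, mem_ptD_of_mem (mem_hnot_of_mem_ptD hp fun hpT => hνp ?_) hp⟩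
  exact (T.toNucleus.monotone hyp).trans_eq (mem_iff_toNucleus_apply.1 hpT)

theorem isTDSpatial_of_forall_sublocale (h : ∀ S : Sublocale L, IsTDSpatial S) :
    IsTDSpatial L := by
  obtain ⟨X, _, hX, ⟨e⟩⟩ := h ⊤
  have htop : ∀ x : L, x ∈ (⊤ : Sublocale L) := fun x => by
    rw [mem_iff_toNucleus_apply, nucleusIsoSublocale.symm_eq_toNucleus, map_top]
    rfl
  exact ⟨X, _, hX, ⟨(RelIso.ofSurjective (OrderEmbedding.ofMapLEIff
    (fun x => (⟨x, htop x⟩ : (⊤ : Sublocale L))) fun _ _ => Iff.rfl) fun x => ⟨x, rfl⟩).trans e⟩⟩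

end Sublocales

end TDLocale

theorem theorem3 (L : Type u) [Order.Frame L] :
    List.TFAE [
      ∀ S : Sublocale L, TDLocale.IsTDSpatial S,
      ∀ S : Sublocale L, TDLocale.IsDSublocale S → TDLocale.IsTDSpatial S,
      (TDLocale.frakM ∘ TDLocale.ptDMap : TDLocale.SD L → TDLocale.SD L) = id,
      Nonempty (TDLocale.SD L ≃o Set (TDLocale.ptD L)),
      TDLocale.IsSpatial (TDLocale.SD L)ᵒᵈ ∧ TDLocale.IsBoolean (TDLocale.SD L),
      TDLocale.IsCompleteAtomicBoolean (TDLocale.SD L),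
      {S : Sublocale L | TDLocale.IsDSublocale S} = TDLocale.Sb L ∧ TDLocale.IsTDSpatial L,
      ∀ S : Sublocale L, S ≠ ⊥ → (TDLocale.ptD S).Nonempty] := by
  tfae_have 1 → 2 := fun h S _ => h S
  tfae_have 2 → 3 := fun h => funext fun S => TDLocale.frakM_ptDMap_of_isTDSpatial (h S.1 S.2)
  tfae_have 3 → 4 := TDLocale.nonempty_orderIso_of_frakM_comp_ptDMap
  tfae_have 4 → 5 := fun ⟨e⟩ => TDLocale.isSpatial_and_isBoolean_of_orderIso_set e
  tfae_have 4 → 6 := fun ⟨e⟩ => TDLocale.isCompleteAtomicBoolean_of_orderIso_set e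
  tfae_have 5 → 8 := fun h S hS =>
    have := TDLocale.isAtomic_of_isSpatial_of_isBoolean h.1 h.2
    TDLocale.exists_ptD_of_isAtomic hS
  tfae_have 6 → 8 := fun h S hS =>
    have := TDLocale.isAtomic_of_isCompleteAtomicBoolean h
    TDLocale.exists_ptD_of_isAtomic hS
  tfae_have 8 → 1 := TDLocale.isTDSpatial_of_forall_ptD_nonempty
  tfae_have 1 → 7 := fun h =>
    ⟨TDLocale.setOf_isDSublocale_eq_Sb h, TDLocale.isTDSpatial_of_forall_sublocale h⟩
  tfae_have 7 → 8 := by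
    rintro ⟨hSb, hL⟩ S hS
    by_contra hempty
    have hSD : S ∈ {S : Sublocale L | TDLocale.IsDSublocale S} :=
      TDLocale.isDSublocale_of_ptD_eq_empty (Set.not_nonempty_iff_eq_empty.1 hempty)
    rw [hSb] at hSD
    obtain ⟨T, rfl⟩ := hSD
    exact hempty (TDLocale.exists_ptD_hnot hL hS)
  tfae_finish
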